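/- Consider a linear Gaussian process $x_{k+1}=Ax_k+w_k$ in $\mathbb R^l$ with measurements $y_k=Cx_k+v_k$ in $\mathbb R^m$, where the noises have covariances $Q\succeq 0$ and $R\succ 0$. Let $\bar P$ be a steady-state a posteriori error covariance of the Kalman filter, i.e. a limit of the recursion $P_{k|k-1}=AP_{k-1|k-1}A^{\mathsf T}+Q$, $P_{k|k}=(I-K_kC)P_{k|k-1}$, $K_k=P_{k|k-1}C^{\mathsf T}(CP_{k|k-1}C^{\mathsf T}+R)^{-1}$, started at some positive semidefinite matrix. For $\delta\ge 1$ put $$f(\delta)=\operatorname{tr}\Big(A^{\delta}\bar P(A^{\mathsf T})^{\delta}+\sum_{r=0}^{\delta-1}A^{r}Q(A^{\mathsf T})^{r}\Big).$$ Let $\theta:\mathbb N^+\to[0,1]$ be non-increasing, put $\bar\theta=1-\theta$, and let $\tau_{\mathrm D},\delta_{\mathrm R}>1$ be integers. Consider the Markov decision process with states $s=(\tau,\delta)\in\mathcal S=\mathbb N^+\times\mathbb N^+$ ($\tau$ is the age of channel, AoC, and $\delta$ the age of information, AoI) and actions $u\in\mathcal U=\{0,1,2\}$ (idle, transmit, renew).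 Its costs are $c(s,0)=c(s,1)=f(\delta)$ and $c(s,2)=\sum_{r=0}^{\delta_{\mathrm R}-1}f(\delta+r)$. Under $u=0$ the state $(\tau,\delta)$ moves to $(\tau+1,\delta+1)$; under $u=1$ it moves to $(\tau+\tau_{\mathrm D},1)$ with probability $\theta(\tau)$ and to $(\tau+\tau_{\mathrm D},\delta+1)$ with probability $\bar\theta(\tau)$; under $u=2$ it moves to $(1,\delta+\delta_{\mathrm R})$. Write $P_{s,s'}(u)$ for the transition probabilities. A real function $V$ on $\mathcal S$ is called a relative value function of the average-cost problem if for some reference state $s_{\mathrm{ref}}$ it arises in one of the following two ways. (a) Let $V_\alpha(s)=\inf_\pi \mathbb E^\pi\big[\sum_{t\ge 0}\alpha^t c(s_t,u_t)\mid s_0=s\big]$, the infimum being over all history-dependent (possibly randomized) policies. There are discount factors $\alpha_n\in(0,1)$ with $\alpha_n\to 1$ and $V_{\alpha_n}(s)<\infty$ for all $n$ and $s$, such that $V(s)=\lim_{n\to\infty}\big(V_{\alpha_n}(s)-V_{\alpha_n}(s_{\mathrm{ref}})\big)$ for every $s$ (in particular, $V$ may be the limit as $\alpha\uparrow 1$).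 (b) $V(s)=\lim_{n\to\infty}V^n(s)$ for every $s$, where $V^n$ are the iterates of relative value iteration, $$\tilde V^{n}(s)=\min_{u\in\mathcal U}\Big[c(s,u)+\sum_{s'}P_{s,s'}(u)V^{n-1}(s')\Big],\qquad V^{n}(s)=\tilde V^{n}(s)-\tilde V^{n}(s_{\mathrm{ref}}),$$ started at a function $V^0$ that is non-decreasing in $\tau$ and in $\delta$ (for instance $V^0=0$). Then every relative value function $V$ satisfies: (i) for every $\tau\in\mathbb N^+$, $V(\tau,\delta)$ is non-decreasing in $\delta$; (ii) for every $\delta\in\mathbb N^+$, $V(\tau,\delta)$ is non-decreasing in $\tau$. -/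

import Mathlib

open Filter Topology
open scoped ENNReal Matrix

namespace WearingChannel

noncomputable section

/-- A linear Gaussian process `x_{k+1} = A x_k + w_k` with state in `ℝ^l`, measured as
`y_k = C x_k + v_k` in `ℝ^m`, with noise covariances `Q ⪰ 0` and `R ≻ 0`, whose local estimates
are sent over a channel that wears out. -/
structure System (l m : ℕ) where
  /-- state transition matrix -/
  A : Matrix (Fin l) (Fin l) ℝ
  /-- covariance of the process noise -/
  Q : Matrix (Fin l) (Fin l) ℝ
  /-- measurement matrix -/
  C : Matrix (Fin m) (Fin l) ℝ
  /-- covariance of the measurement noise -/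
  R : Matrix (Fin m) (Fin m) ℝ
  Q_posSemidef : Q.PosSemidef
  R_posDef : R.PosDef
  /-- `θ τ` is the probability of a successful transmission when the age of channel is `τ` -/
  θ : ℕ+ → ℝ
  θ_antitone : Antitone θ
  θ_nonneg : ∀ τ, 0 ≤ θ τ
  θ_le_one : ∀ τ, θ τ ≤ 1
  /-- wear of the channel caused by one transmission -/
  τD : ℕ+
  one_lt_τD : 1 < τD
  /-- number of time slots that a channel renewal takes -/
  δR : ℕ+
  one_lt_δR : 1 < δR

/-- A state is a pair `(τ, δ)`: age of channel (AoC) and age of information (AoI). -/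
abbrev State := ℕ+ × ℕ+

/-- The actions: `0` is idle, `1` is transmit, `2` is renewal. -/
abbrev Action := Fin 3

/-- A history is the list of the past states and actions, the most recent one first; its length
is the current decision epoch. -/
abbrev History := List (State × Action)

/-- An admissible policy: at each epoch it selects an action, possibly at random, given the
past states and actions and the current state. -/
abbrev Policy := History → State → PMF Action

namespace System

variable {l m : ℕ} (M : System l m)

/-! ### The local Kalman filter -/

/-- The a priori error covariance computed from the previous a posteriori one. -/
def prioriCov (P : Matrix (Fin l) (Fin l) ℝ) : Matrix (Fin l) (Fin l) ℝ :=
  M.A * P * M.Aᵀ + M.Q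

/-- The Kalman gain for the a priori error covariance `P`. -/
def kalmanGain (P : Matrix (Fin l) (Fin l) ℝ) : Matrix (Fin l) (Fin m) ℝ :=
  P * M.Cᵀ * (M.C * P * M.Cᵀ + M.R)⁻¹

/-- The a posteriori error covariance of the filter at time slot `k`, started at `P₀`. -/
def filterCov (P₀ : Matrix (Fin l) (Fin l) ℝ) : ℕ → Matrix (Fin l) (Fin l) ℝ
  | 0 => P₀
  | k + 1 => (1 - M.kalmanGain (M.prioriCov (filterCov P₀ k)) * M.C) *
      M.prioriCov (filterCov P₀ k)

/-- `Pbar` is a steady-state value of the error covariance of the filter. -/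
def IsSteadyStateCov (Pbar : Matrix (Fin l) (Fin l) ℝ) : Prop :=
  ∃ P₀ : Matrix (Fin l) (Fin l) ℝ, P₀.PosSemidef ∧
    Tendsto (M.filterCov P₀) atTop (𝓝 Pbar)

/-! ### The cost -/

/-- The error covariance at the receiver when the AoI is `δ` and the local filter is in its
steady state `Pbar`. -/
def receiverCov (Pbar : Matrix (Fin l) (Fin l) ℝ) (δ : ℕ) : Matrix (Fin l) (Fin l) ℝ :=
  M.A ^ δ * Pbar * M.Aᵀ ^ δ + ∑ r ∈ Finset.range δ, M.A ^ r * M.Q * M.Aᵀ ^ r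

/-- The mean square error at the receiver when the AoI is `δ`. -/
def mse (Pbar : Matrix (Fin l) (Fin l) ℝ) (δ : ℕ) : ℝ :=
  (M.receiverCov Pbar δ).trace

/-- The cost of taking an action in a state. -/
def cost (Pbar : Matrix (Fin l) (Fin l) ℝ) (s : State) : Action → ℝ
  | 0 => M.mse Pbar s.2
  | 1 => M.mse Pbar s.2
  | 2 => ∑ r ∈ Finset.range (M.δR : ℕ), M.mse Pbar (s.2 + r)

/-! ### The transition law -/

/-- The law of the outcome (success or not) of a transmission when the AoC is `τ`. -/
def channel (τ : ℕ+) : PMF Bool :=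
  PMF.ofFintype (fun h => ENNReal.ofReal (if h then M.θ τ else 1 - M.θ τ)) (by
    have h0 := M.θ_nonneg τ
    have h1 := M.θ_le_one τ
    rw [Fintype.sum_bool, if_pos rfl, if_neg (by decide), ← ENNReal.ofReal_add h0 (by linarith)]
    simp)

/-- The law of the next state, given the current state and action. -/
def transition (s : State) : Action → PMF State
  | 0 => PMF.pure (s.1 + 1, s.2 + 1)
  | 1 => (M.channel s.1).map fun h => (s.1 + M.τD, if h then 1 else s.2 + 1)
  | 2 => PMF.pure (1, s.2 + M.δR)

/-- The transition probability from `s` to `s'` under the action `u`. -/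
def prob (s : State) (u : Action) (s' : State) : ℝ := (M.transition s u s').toReal

/-! ### Relative value iteration -/

/-- The Q-factor for the value function `W`. -/
def qFactor (Pbar : Matrix (Fin l) (Fin l) ℝ) (W : State → ℝ) (s : State) (u : Action) : ℝ :=
  M.cost Pbar s u + ∑' s' : State, M.prob s u s' * W s'

/-- The minimum over the actions of the Q-factor for `W`. -/
def bellman (Pbar : Matrix (Fin l) (Fin l) ℝ) (W : State → ℝ) (s : State) : ℝ :=
  Finset.univ.inf' Finset.univ_nonempty (M.qFactor Pbar W s)

/-- The `n`-th iterate of relative value iteration with reference state `sRef`, started at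
`V₀`. -/
def rvi (Pbar : Matrix (Fin l) (Fin l) ℝ) (sRef : State) (V₀ : State → ℝ) : ℕ → State → ℝ
  | 0 => V₀
  | n + 1 => fun s => M.bellman Pbar (rvi Pbar sRef V₀ n) s -
      M.bellman Pbar (rvi Pbar sRef V₀ n) sRef

/-- `V` is the pointwise limit of relative value iteration, started at some function that is
non-decreasing in each of the two ages (for instance at `0`). -/
def IsRVILimit (Pbar : Matrix (Fin l) (Fin l) ℝ) (sRef : State) (V : State → ℝ) : Prop :=
  ∃ V₀ : State → ℝ, (∀ τ, Monotone fun δ => V₀ (τ, δ)) ∧ (∀ δ, Monotone fun τ => V₀ (τ, δ)) ∧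
    ∀ s, Tendsto (fun n => M.rvi Pbar sRef V₀ n s) atTop (𝓝 (V s))

/-! ### The discounted problem and its vanishing-discount limit -/

/-- The law of the history and the state at each decision epoch under the policy `π`, started
in `s₀`. -/
def law (π : Policy) (s₀ : State) : ℕ → PMF (History × State)
  | 0 => PMF.pure ([], s₀)
  | t + 1 => (law π s₀ t).bind fun x => (π x.1 x.2).bind fun u =>
      (M.transition x.2 u).map fun s' => ((x.2, u) :: x.1, s')

/-- The expected cost at epoch `t` under the policy `π`, started in `s₀`. -/
def expectedCost (Pbar : Matrix (Fin l) (Fin l) ℝ) (π : Policy) (s₀ : State) (t : ℕ) : ℝ≥0∞ :=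
  ∑' x : History × State, M.law π s₀ t x *
    ∑ u : Action, π x.1 x.2 u * ENNReal.ofReal (M.cost Pbar x.2 u)

/-- The minimal expected total `α`-discounted cost over all admissible policies. -/
def discountedValue (Pbar : Matrix (Fin l) (Fin l) ℝ) (α : ℝ) (s₀ : State) : ℝ≥0∞ :=
  ⨅ π : Policy, ∑' t : ℕ, ENNReal.ofReal α ^ t * M.expectedCost Pbar π s₀ t

/-- The `α`-discounted relative value function with reference state `sRef`. -/
def discountedRelValue (Pbar : Matrix (Fin l) (Fin l) ℝ) (sRef : State) (α : ℝ) (s : State) : ℝ :=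
  (M.discountedValue Pbar α s).toReal - (M.discountedValue Pbar α sRef).toReal

/-- `V` is the pointwise limit of the discounted relative value functions, all of whose
discounted values are finite, along some sequence of discount factors in `(0, 1)` tending
to `1`. In particular this holds if the full limit as `α ↑ 1` exists. -/
def IsVanishingDiscountLimit (Pbar : Matrix (Fin l) (Fin l) ℝ) (sRef : State) (V : State → ℝ) :
    Prop :=
  ∃ α : ℕ → ℝ, (∀ n, 0 < α n ∧ α n < 1) ∧ Tendsto α atTop (𝓝 1) ∧
    (∀ n s, M.discountedValue Pbar (α n) s ≠ ⊤) ∧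
    ∀ s, Tendsto (fun n => M.discountedRelValue Pbar sRef (α n) s) atTop (𝓝 (V s))

/-- `V` is a relative value function of the average-cost problem, obtained for some reference
state from the discounted problems or from relative value iteration. -/
def IsRelativeValueFunction (Pbar : Matrix (Fin l) (Fin l) ℝ) (V : State → ℝ) : Prop :=
  ∃ sRef : State, M.IsVanishingDiscountLimit Pbar sRef V ∨ M.IsRVILimit Pbar sRef V

end System

end

end WearingChannel

/-! Monotonicity is proved for the product order on states, which gives (i) and (ii) together. The
cost is monotone because a measurement update never increases the covariance: in the limit, `A *
Pbar * Aᵀ + Q - Pbar` has nonnegative trace after any congruence, and the increments of `mse` are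
such traces (`monotone_mse`). Each Bellman step then preserves monotone functions. Idling and
renewal move ordered states to ordered states; for a transmission, an older channel also shifts
probability from the fresh outcome to the stale, costlier one. Hence all iterates of relative value
iteration are monotone, and so is their limit. For the discounted problem, the optimum over all
history-dependent policies is the supremum of value iteration started at `0`
(`discountedValue_eq_iSup`), so it is monotone too; subtracting the reference value and letting the
discount factor tend to `1` keeps this. -/

namespace WearingChannel

/-! ### Expectations of extended nonnegative functions under a `PMF` -/

/-- The expectation of an extended nonnegative function under a probability mass function. -/
noncomputable def lmean {ι : Type*} (p : PMF ι) (g : ι → ℝ≥0∞) : ℝ≥0∞ := ∑' a, p a * g a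

section lmean

variable {ι κ : Type*}

theorem lmean_pure (a : ι) (g : ι → ℝ≥0∞) : lmean (PMF.pure a) g = g a := by
  rw [lmean, tsum_eq_single a fun b hb => by simp [PMF.pure_apply, hb]]
  simp

theorem lmean_bind (p : PMF ι) (f : ι → PMF κ) (g : κ → ℝ≥0∞) :
    lmean (p.bind f) g = lmean p fun a => lmean (f a) g := by
  simp only [lmean, PMF.bind_apply, ← ENNReal.tsum_mul_right, ← ENNReal.tsum_mul_left]
  rw [ENNReal.tsum_comm]
  simp only [mul_assoc]

theorem lmean_map (p : PMF ι) (f : ι → κ) (g : κ → ℝ≥0∞) :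
    lmean (p.map f) g = lmean p (g ∘ f) := by
  rw [← PMF.bind_pure_comp, lmean_bind]
  simp only [Function.comp_apply, lmean_pure]
  rfl

theorem lmean_mono (p : PMF ι) {g h : ι → ℝ≥0∞} (hgh : g ≤ h) : lmean p g ≤ lmean p h :=
  ENNReal.tsum_le_tsum fun a => mul_le_mul_right (hgh a) _

theorem lmean_add (p : PMF ι) (g h : ι → ℝ≥0∞) :
    lmean p (fun a => g a + h a) = lmean p g + lmean p h := by
  simp only [lmean, mul_add, ENNReal.tsum_add]

theorem lmean_const_mul (p : PMF ι) (c : ℝ≥0∞) (g : ι → ℝ≥0∞) :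
    lmean p (fun a => c * g a) = c * lmean p g := by
  simp only [lmean, mul_left_comm _ c, ENNReal.tsum_mul_left]

theorem lmean_const (p : PMF ι) (c : ℝ≥0∞) : lmean p (fun _ => c) = c := by
  rw [lmean, ENNReal.tsum_mul_right, p.tsum_coe, one_mul]

end lmean

namespace System

variable {l m : ℕ} (M : System l m)

/-! ### Monotonicity of the cost -/

theorem isUnit_det_innovationCov {P : Matrix (Fin l) (Fin l) ℝ} (hP : P.PosSemidef) :
    IsUnit (M.C * P * M.Cᵀ + M.R).det := by
  have h : (M.C * P * M.Cᵀ).PosSemidef := by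
    simpa using hP.mul_mul_conjTranspose_same M.C
  exact (Matrix.isUnit_iff_isUnit_det _).1 (M.R_posDef.posSemidef_add h).isUnit

theorem posSemidef_prioriCov {P : Matrix (Fin l) (Fin l) ℝ} (hP : P.PosSemidef) :
    (M.prioriCov P).PosSemidef := by
  have h : (M.A * P * M.Aᵀ).PosSemidef := by
    simpa using hP.mul_mul_conjTranspose_same M.A
  exact h.add M.Q_posSemidef

/-- The Joseph form of the measurement update. -/
theorem update_eq_joseph {P : Matrix (Fin l) (Fin l) ℝ} (hP : P.PosSemidef) :
    (1 - M.kalmanGain P * M.C) * P =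
      (1 - M.kalmanGain P * M.C) * P * (1 - M.kalmanGain P * M.C)ᵀ +
        M.kalmanGain P * M.R * (M.kalmanGain P)ᵀ := by
  have hS : M.kalmanGain P * (M.C * P * M.Cᵀ + M.R) = P * M.Cᵀ := by
    rw [kalmanGain, Matrix.mul_assoc, Matrix.nonsing_inv_mul _ (M.isUnit_det_innovationCov hP),
      Matrix.mul_one]
  have hR : M.kalmanGain P * M.R = P * M.Cᵀ - M.kalmanGain P * M.C * P * M.Cᵀ := by
    rw [← hS, Matrix.mul_add]
    simp only [Matrix.mul_assoc, add_sub_cancel_left]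
  rw [hR, Matrix.transpose_sub, Matrix.transpose_one, Matrix.transpose_mul]
  simp only [Matrix.sub_mul, Matrix.mul_sub, Matrix.one_mul, Matrix.mul_one, Matrix.mul_assoc]
  abel

/-- The Joseph form is a sum of two congruences, of `P` and of `R`. -/
theorem posSemidef_update {P : Matrix (Fin l) (Fin l) ℝ} (hP : P.PosSemidef) :
    ((1 - M.kalmanGain P * M.C) * P).PosSemidef := by
  rw [M.update_eq_joseph hP]
  refine Matrix.PosSemidef.add ?_ ?_
  · exact Matrix.conjTranspose_eq_transpose_of_trivial (1 - M.kalmanGain P * M.C) ▸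
      hP.mul_mul_conjTranspose_same (1 - M.kalmanGain P * M.C)
  · simpa using M.R_posDef.posSemidef.mul_mul_conjTranspose_same (M.kalmanGain P)

/-- The reduction is a congruence of the inverse innovation covariance by `P * Cᵀ`. -/
theorem posSemidef_sub_update {P : Matrix (Fin l) (Fin l) ℝ} (hP : P.PosSemidef) :
    (P - (1 - M.kalmanGain P * M.C) * P).PosSemidef := by
  have hC : (M.C * P * M.Cᵀ).PosSemidef := by
    simpa using hP.mul_mul_conjTranspose_same M.C
  have hS := (M.R_posDef.posSemidef_add hC).inv.posSemidef
  have hPt : Pᵀ = P := by simpa using hP.isHermitian.eq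
  have key : P - (1 - M.kalmanGain P * M.C) * P =
      P * M.Cᵀ * (M.C * P * M.Cᵀ + M.R)⁻¹ * (P * M.Cᵀ)ᵀ := by
    rw [kalmanGain, Matrix.transpose_mul, Matrix.transpose_transpose, hPt, Matrix.sub_mul, Matrix.one_mul,
      sub_sub_cancel]
    simp only [Matrix.mul_assoc]
  rw [key]
  simpa using hS.mul_mul_conjTranspose_same (P * M.Cᵀ)

theorem posSemidef_filterCov {P₀ : Matrix (Fin l) (Fin l) ℝ} (h₀ : P₀.PosSemidef) (k : ℕ) :
    (M.filterCov P₀ k).PosSemidef := by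
  induction k with
  | zero => exact h₀
  | succ k ih => exact M.posSemidef_update (M.posSemidef_prioriCov ih)

theorem continuous_trace_prioriCov_sub (B : Matrix (Fin l) (Fin l) ℝ) :
    Continuous fun X : Matrix (Fin l) (Fin l) ℝ × Matrix (Fin l) (Fin l) ℝ =>
      (B * (M.prioriCov X.1 - X.2) * Bᵀ).trace := by
  have h : Continuous fun X : Matrix (Fin l) (Fin l) ℝ × Matrix (Fin l) (Fin l) ℝ =>
      M.prioriCov X.1 :=
    ((continuous_const.matrix_mul continuous_fst).matrix_mul continuous_const).add
      continuous_const
  exact ((continuous_const.matrix_mul (h.sub continuous_snd)).matrix_mul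
    continuous_const).matrix_trace

theorem trace_sub_filterCov_succ_nonneg {P₀ : Matrix (Fin l) (Fin l) ℝ} (h₀ : P₀.PosSemidef)
    (B : Matrix (Fin l) (Fin l) ℝ) (k : ℕ) :
    0 ≤ (B * (M.prioriCov (M.filterCov P₀ k) - M.filterCov P₀ (k + 1)) * Bᵀ).trace := by
  have h : (M.prioriCov (M.filterCov P₀ k) - M.filterCov P₀ (k + 1)).PosSemidef :=
    M.posSemidef_sub_update (M.posSemidef_prioriCov (M.posSemidef_filterCov h₀ k))
  rw [← Matrix.conjTranspose_eq_transpose_of_trivial B]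
  exact (h.mul_mul_conjTranspose_same B).trace_nonneg

/-- Consecutive filter covariances both tend to `Pbar`, so the inequality along the filter passes to
the limit. No fixed-point equation for `Pbar` is needed, hence no continuity of the gain. -/
theorem trace_prioriCov_sub_nonneg {Pbar : Matrix (Fin l) (Fin l) ℝ}
    (hPbar : M.IsSteadyStateCov Pbar) (B : Matrix (Fin l) (Fin l) ℝ) :
    0 ≤ (B * (M.prioriCov Pbar - Pbar) * Bᵀ).trace := by
  obtain ⟨P₀, h₀, hlim⟩ := hPbar
  have hsucc : Tendsto (fun k => M.filterCov P₀ (k + 1)) atTop (𝓝 Pbar) :=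
    hlim.comp (tendsto_add_atTop_nat 1)
  have htrace := ((M.continuous_trace_prioriCov_sub B).tendsto (Pbar, Pbar)).comp
    (hlim.prodMk_nhds hsucc)
  exact ge_of_tendsto' htrace fun k => M.trace_sub_filterCov_succ_nonneg h₀ B k

theorem monotone_mse {Pbar : Matrix (Fin l) (Fin l) ℝ} (hPbar : M.IsSteadyStateCov Pbar) :
    Monotone (M.mse Pbar) := by
  refine monotone_nat_of_le_succ fun δ => ?_
  have h := M.trace_prioriCov_sub_nonneg hPbar (M.A ^ δ)
  have key : M.receiverCov Pbar (δ + 1) = M.receiverCov Pbar δ +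
      M.A ^ δ * (M.prioriCov Pbar - Pbar) * (M.A ^ δ)ᵀ := by
    rw [receiverCov, receiverCov, prioriCov, Finset.sum_range_succ, Matrix.transpose_pow,
      pow_succ M.A, pow_succ' M.Aᵀ]
    noncomm_ring
  rw [mse, mse, key, Matrix.trace_add]
  linarith

theorem monotone_cost {Pbar : Matrix (Fin l) (Fin l) ℝ} (hPbar : M.IsSteadyStateCov Pbar)
    (u : Action) : Monotone fun s => M.cost Pbar s u := by
  intro s t hst
  have h2 : (s.2 : ℕ) ≤ t.2 := hst.2
  fin_cases u
  · exact M.monotone_mse hPbar h2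
  · exact M.monotone_mse hPbar h2
  · exact Finset.sum_le_sum fun r _ => M.monotone_mse hPbar (Nat.add_le_add_right h2 r)

/-! ### Relative value iteration -/

theorem tsum_prob_zero (W : State → ℝ) (s : State) :
    ∑' s', M.prob s 0 s' * W s' = W (s.1 + 1, s.2 + 1) := by
  rw [tsum_eq_single (s.1 + 1, s.2 + 1) fun b hb => by
    simp [prob, transition, PMF.pure_apply, hb]]
  simp [prob, transition]

theorem tsum_prob_two (W : State → ℝ) (s : State) :
    ∑' s', M.prob s 2 s' * W s' = W (1, s.2 + M.δR) := by
  rw [tsum_eq_single (1, s.2 + M.δR) fun b hb => by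
    simp [prob, transition, PMF.pure_apply, hb]]
  simp [prob, transition]

theorem prob_one (s s' : State) : M.prob s 1 s' =
    (if s' = (s.1 + M.τD, 1) then M.θ s.1 else 0) +
      if s' = (s.1 + M.τD, s.2 + 1) then 1 - M.θ s.1 else 0 := by
  have h0 := M.θ_nonneg s.1
  have h1 : 0 ≤ 1 - M.θ s.1 := sub_nonneg.2 (M.θ_le_one s.1)
  simp only [prob, transition, PMF.map_apply, tsum_bool, channel, PMF.ofFintype_apply]
  rw [add_comm, ENNReal.toReal_add (by split_ifs <;> simp) (by split_ifs <;> simp)]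
  congr 1
  · split_ifs <;> simp_all
  · split_ifs <;> simp_all

theorem tsum_prob_one (W : State → ℝ) (s : State) :
    ∑' s', M.prob s 1 s' * W s' =
      M.θ s.1 * W (s.1 + M.τD, 1) + (1 - M.θ s.1) * W (s.1 + M.τD, s.2 + 1) := by
  have h (a : State) (c : ℝ) :
      HasSum (fun s' => (if s' = a then c else 0) * W s') (c * W a) := by
    convert hasSum_single (f := fun s' => (if s' = a then c else 0) * W s') a
      (fun b hb => by simp [hb]) using 1
    simp
  simp only [prob_one, add_mul]
  exact ((h _ _).add (h _ _)).tsum_eq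

theorem monotone_qFactor {Pbar : Matrix (Fin l) (Fin l) ℝ} (hPbar : M.IsSteadyStateCov Pbar)
    {W : State → ℝ} (hW : Monotone W) (u : Action) :
    Monotone fun s => M.qFactor Pbar W s u := by
  refine (M.monotone_cost hPbar u).add ?_
  intro s t hst
  have h1 : s.1 ≤ t.1 := hst.1
  have h2 : s.2 ≤ t.2 := hst.2
  fin_cases u
  · change ∑' s', M.prob s 0 s' * W s' ≤ ∑' s', M.prob t 0 s' * W s'
    rw [tsum_prob_zero, tsum_prob_zero]
    exact hW ⟨add_le_add_left h1 1, add_le_add_left h2 1⟩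
  · change ∑' s', M.prob s 1 s' * W s' ≤ ∑' s', M.prob t 1 s' * W s'
    rw [tsum_prob_one, tsum_prob_one]
    have hx : W (s.1 + M.τD, 1) ≤ W (t.1 + M.τD, 1) :=
      hW ⟨add_le_add_left h1 _, le_rfl⟩
    have hy : W (s.1 + M.τD, s.2 + 1) ≤ W (t.1 + M.τD, t.2 + 1) :=
      hW ⟨add_le_add_left h1 _, add_le_add_left h2 1⟩
    have hxy : W (t.1 + M.τD, 1) ≤ W (t.1 + M.τD, t.2 + 1) :=
      hW ⟨le_rfl, one_le⟩
    have hθ := M.θ_antitone h1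
    -- The difference of the two sides is `θ s.1` times the gap in `hx`, plus `1 - θ s.1` times the
    -- gap in `hy`, plus `θ s.1 - θ t.1` times the gap in `hxy`.
    nlinarith [mul_le_mul_of_nonneg_left hx (M.θ_nonneg s.1),
      mul_le_mul_of_nonneg_left hy (sub_nonneg.2 (M.θ_le_one s.1)),
      mul_nonneg (sub_nonneg.2 hθ) (sub_nonneg.2 hxy)]
  · change ∑' s', M.prob s 2 s' * W s' ≤ ∑' s', M.prob t 2 s' * W s'
    rw [tsum_prob_two, tsum_prob_two]
    exact hW ⟨le_rfl, add_le_add_left h2 _⟩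

theorem monotone_bellman {Pbar : Matrix (Fin l) (Fin l) ℝ} (hPbar : M.IsSteadyStateCov Pbar)
    {W : State → ℝ} (hW : Monotone W) : Monotone (M.bellman Pbar W) := by
  intro s t hst
  exact Finset.le_inf' _ _ fun u hu =>
    (Finset.inf'_le _ hu).trans (M.monotone_qFactor hPbar hW u hst)

theorem monotone_rvi {Pbar : Matrix (Fin l) (Fin l) ℝ} (hPbar : M.IsSteadyStateCov Pbar)
    (sRef : State) {V₀ : State → ℝ} (h₀ : Monotone V₀) (n : ℕ) :
    Monotone (M.rvi Pbar sRef V₀ n) := by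
  induction n with
  | zero => exact h₀
  | succ n ih => exact fun s t hst => sub_le_sub_right (M.monotone_bellman hPbar ih hst) _

theorem IsRVILimit.monotone {M : System l m} {Pbar : Matrix (Fin l) (Fin l) ℝ}
    (hPbar : M.IsSteadyStateCov Pbar) {sRef : State} {V : State → ℝ}
    (hV : M.IsRVILimit Pbar sRef V) : Monotone V := by
  obtain ⟨V₀, hδ, hτ, hlim⟩ := hV
  have h₀ : Monotone V₀ := fun s t hst => (hδ s.1 hst.2).trans (hτ t.2 hst.1)
  exact fun s t hst => le_of_tendsto_of_tendsto' (hlim s) (hlim t)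
    fun n => M.monotone_rvi hPbar sRef h₀ n hst

/-! ### Discounted value iteration -/

/-- The discounted Q-factor for an extended nonnegative value function. -/
noncomputable def discountedQFactor (Pbar : Matrix (Fin l) (Fin l) ℝ) (a : ℝ≥0∞)
    (W : State → ℝ≥0∞) (s : State) (u : Action) : ℝ≥0∞ :=
  ENNReal.ofReal (M.cost Pbar s u) + a * lmean (M.transition s u) W

/-- The iterates of discounted value iteration, started at `0`. -/
noncomputable def discountedIterate (Pbar : Matrix (Fin l) (Fin l) ℝ) (a : ℝ≥0∞) :
    ℕ → State → ℝ≥0∞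
  | 0 => 0
  | n + 1 => fun s => ⨅ u, M.discountedQFactor Pbar a (discountedIterate Pbar a n) s u

theorem lmean_transition_one (W : State → ℝ≥0∞) (s : State) :
    lmean (M.transition s 1) W =
      ENNReal.ofReal (M.θ s.1) * W (s.1 + M.τD, 1) +
        ENNReal.ofReal (1 - M.θ s.1) * W (s.1 + M.τD, s.2 + 1) := by
  rw [transition, lmean_map, lmean, tsum_bool, add_comm]
  simp [channel]

theorem monotone_lmean_transition {W : State → ℝ≥0∞} (hW : Monotone W) (u : Action) :
    Monotone fun s => lmean (M.transition s u) W := by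
  intro s t hst
  have h1 : s.1 ≤ t.1 := hst.1
  have h2 : s.2 ≤ t.2 := hst.2
  fin_cases u
  · change lmean (PMF.pure _) W ≤ lmean (PMF.pure _) W
    rw [lmean_pure, lmean_pure]
    exact hW ⟨add_le_add_left h1 1, add_le_add_left h2 1⟩
  · change lmean (M.transition s 1) W ≤ lmean (M.transition t 1) W
    rw [lmean_transition_one, lmean_transition_one]
    have hx : W (s.1 + M.τD, 1) ≤ W (t.1 + M.τD, 1) :=
      hW ⟨add_le_add_left h1 _, le_rfl⟩
    have hy : W (s.1 + M.τD, s.2 + 1) ≤ W (t.1 + M.τD, t.2 + 1) :=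
      hW ⟨add_le_add_left h1 _, add_le_add_left h2 1⟩
    have hxy : W (t.1 + M.τD, 1) ≤ W (t.1 + M.τD, t.2 + 1) :=
      hW ⟨le_rfl, one_le⟩
    have hθ : 0 ≤ M.θ s.1 - M.θ t.1 := sub_nonneg.2 (M.θ_antitone h1)
    -- The mass `θ s.1 - θ t.1` is split off on both sides: it weights the fresh state from `s` and
    -- the stale state from `t`. This avoids truncated subtraction.
    have hs : ENNReal.ofReal (M.θ s.1) =
        ENNReal.ofReal (M.θ t.1) + ENNReal.ofReal (M.θ s.1 - M.θ t.1) := by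
      rw [← ENNReal.ofReal_add (M.θ_nonneg _) hθ, add_sub_cancel]
    have ht : ENNReal.ofReal (1 - M.θ t.1) =
        ENNReal.ofReal (M.θ s.1 - M.θ t.1) + ENNReal.ofReal (1 - M.θ s.1) := by
      rw [← ENNReal.ofReal_add hθ (sub_nonneg.2 (M.θ_le_one _))]
      congr 1
      ring
    rw [hs, ht, add_mul, add_mul, add_assoc]
    gcongr
    exact hx.trans hxy
  · change lmean (PMF.pure _) W ≤ lmean (PMF.pure _) W
    rw [lmean_pure, lmean_pure]
    exact hW ⟨le_rfl, add_le_add_left h2 _⟩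

theorem monotone_discountedIterate {Pbar : Matrix (Fin l) (Fin l) ℝ}
    (hPbar : M.IsSteadyStateCov Pbar) (a : ℝ≥0∞) (n : ℕ) :
    Monotone (M.discountedIterate Pbar a n) := by
  induction n with
  | zero => exact monotone_const
  | succ n ih =>
    exact fun s t hst => iInf_mono fun u => add_le_add
      (ENNReal.ofReal_le_ofReal (M.monotone_cost hPbar u hst))
      (mul_le_mul_right (M.monotone_lmean_transition ih u hst) a)

theorem discountedQFactor_mono (Pbar : Matrix (Fin l) (Fin l) ℝ) (a : ℝ≥0∞)
    {W W' : State → ℝ≥0∞} (h : W ≤ W') (s : State) (u : Action) :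
    M.discountedQFactor Pbar a W s u ≤ M.discountedQFactor Pbar a W' s u :=
  add_le_add_right (mul_le_mul_right (lmean_mono _ h) _) _

theorem discountedIterate_le_succ (Pbar : Matrix (Fin l) (Fin l) ℝ) (a : ℝ≥0∞) (n : ℕ) :
    M.discountedIterate Pbar a n ≤ M.discountedIterate Pbar a (n + 1) := by
  induction n with
  | zero => exact fun s => zero_le
  | succ n ih => exact fun s => iInf_mono fun u => M.discountedQFactor_mono Pbar a ih s u

/-- Monotone convergence: the sum is a supremum of finite sums, and the two suprema commute. -/
theorem lmean_iSup_of_monotone {ι : Type*} (p : PMF ι) {W : ℕ → ι → ℝ≥0∞} (hW : Monotone W) :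
    lmean p (fun i => ⨆ n, W n i) = ⨆ n, lmean p (W n) := by
  simp only [lmean, ENNReal.mul_iSup]
  rw [ENNReal.tsum_eq_iSup_sum]
  simp_rw [ENNReal.tsum_eq_iSup_sum]
  rw [iSup_comm]
  refine iSup_congr fun F => ?_
  exact ENNReal.finsetSum_iSup_of_monotone fun i j k hjk => mul_le_mul_right (hW hjk i) _

/-- Some action is greedy for the limit of discounted value iteration. -/
theorem exists_discountedQFactor_iSup_le (Pbar : Matrix (Fin l) (Fin l) ℝ) (a : ℝ≥0∞)
    (s : State) : ∃ u, M.discountedQFactor Pbar a (fun s => ⨆ n, M.discountedIterate Pbar a n s) s u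
      ≤ ⨆ n, M.discountedIterate Pbar a n s := by
  have hmono : Monotone (M.discountedIterate Pbar a) :=
    monotone_nat_of_le_succ (M.discountedIterate_le_succ Pbar a)
  have hchoice (n : ℕ) : ∃ u, M.discountedQFactor Pbar a (M.discountedIterate Pbar a n) s u =
      M.discountedIterate Pbar a (n + 1) s :=
    exists_eq_ciInf_of_finite
  choose u hu using hchoice
  -- With finitely many actions, one action `v` is minimizing at infinitely many stages. Each stage
  -- `n` lies below such a stage `k`, so the bound for `v` survives the supremum.
  obtain ⟨v, hv⟩ := Finite.exists_infinite_fiber u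
  refine ⟨v, ?_⟩
  have hv' : (u ⁻¹' {v}).Infinite := Set.infinite_coe_iff.1 hv
  rw [discountedQFactor, lmean_iSup_of_monotone _ hmono, ENNReal.mul_iSup, ENNReal.add_iSup]
  refine iSup_le fun n => ?_
  obtain ⟨k, hk, hnk⟩ := hv'.exists_gt n
  calc M.discountedQFactor Pbar a (M.discountedIterate Pbar a n) s v
      ≤ M.discountedQFactor Pbar a (M.discountedIterate Pbar a k) s v :=
        M.discountedQFactor_mono Pbar a (hmono hnk.le) s v
    _ = M.discountedIterate Pbar a (k + 1) s := by rw [← hu k, hk]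
    _ ≤ _ := le_iSup (fun n => M.discountedIterate Pbar a n s) (k + 1)

/-! ### The discounted value is the limit of value iteration -/

/-- One step of the controlled process: the expected current cost plus the discounted expected
value of the next state is the expectation of the Q-factor. -/
theorem expectedCost_add_lmean_law (Pbar : Matrix (Fin l) (Fin l) ℝ) (a : ℝ≥0∞) (π : Policy)
    (s₀ : State) (W : State → ℝ≥0∞) (t : ℕ) :
    M.expectedCost Pbar π s₀ t + a * lmean (M.law π s₀ (t + 1)) (fun x => W x.2) =
      lmean (M.law π s₀ t) fun x => lmean (π x.1 x.2) (M.discountedQFactor Pbar a W x.2) := by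
  have hcost : M.expectedCost Pbar π s₀ t = lmean (M.law π s₀ t) fun x =>
      lmean (π x.1 x.2) fun u => ENNReal.ofReal (M.cost Pbar x.2 u) := by
    simp only [expectedCost, lmean, tsum_fintype]
  have hlaw : lmean (M.law π s₀ (t + 1)) (fun x => W x.2) = lmean (M.law π s₀ t) fun x =>
      lmean (π x.1 x.2) fun u => lmean (M.transition x.2 u) W := by
    simp only [law, lmean_bind, lmean_map]
    rfl
  rw [hcost, hlaw, ← lmean_const_mul, ← lmean_add]
  congr 1
  funext x
  rw [← lmean_const_mul, ← lmean_add]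
  rfl

/-- Each epoch played by `π` uses up one stage of value iteration, so `k` varies in the induction.
-/
theorem discountedIterate_le (Pbar : Matrix (Fin l) (Fin l) ℝ) (a : ℝ≥0∞) (π : Policy)
    (s₀ : State) (k n : ℕ) : M.discountedIterate Pbar a (n + k) s₀ ≤
      ∑ t ∈ Finset.range n, a ^ t * M.expectedCost Pbar π s₀ t +
        a ^ n * lmean (M.law π s₀ n) fun x => M.discountedIterate Pbar a k x.2 := by
  induction n generalizing k with
  | zero => simp [law, lmean_pure]
  | succ n ih =>
    have hstep : lmean (M.law π s₀ n) (fun x => M.discountedIterate Pbar a (k + 1) x.2) ≤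
        M.expectedCost Pbar π s₀ n +
          a * lmean (M.law π s₀ (n + 1)) fun x => M.discountedIterate Pbar a k x.2 := by
      rw [expectedCost_add_lmean_law]
      refine lmean_mono _ fun x => ?_
      -- The minimum over actions is at most their average under the randomized choice.
      rw [← lmean_const (π x.1 x.2) (M.discountedIterate Pbar a (k + 1) x.2)]
      exact lmean_mono _ fun u => iInf_le _ u
    calc M.discountedIterate Pbar a (n + 1 + k) s₀
        = M.discountedIterate Pbar a (n + (k + 1)) s₀ := by rw [add_right_comm, add_assoc]
      _ ≤ _ := ih (k + 1)
      _ ≤ _ := add_le_add_right (mul_le_mul_right hstep _) _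
      _ = _ := by rw [Finset.sum_range_succ, pow_succ, mul_add, mul_assoc, add_assoc]

/-- Under `g` the accumulated cost plus the discounted value `W` of the current state never
increases in expectation, and it starts at `W s₀`. -/
theorem sum_expectedCost_le_of_greedy (Pbar : Matrix (Fin l) (Fin l) ℝ) (a : ℝ≥0∞)
    {W : State → ℝ≥0∞} {g : State → Action} (hg : ∀ s, M.discountedQFactor Pbar a W s (g s) ≤ W s)
    (s₀ : State) (n : ℕ) :
    ∑ t ∈ Finset.range n, a ^ t * M.expectedCost Pbar (fun _ s => PMF.pure (g s)) s₀ t +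
      a ^ n * lmean (M.law (fun _ s => PMF.pure (g s)) s₀ n) (fun x => W x.2) ≤ W s₀ := by
  induction n with
  | zero => simp [law, lmean_pure]
  | succ n ih =>
    refine le_trans ?_ ih
    rw [Finset.sum_range_succ, pow_succ, mul_assoc, add_assoc, ← mul_add,
      expectedCost_add_lmean_law]
    refine add_le_add_right (mul_le_mul_right (lmean_mono _ fun x => ?_) _) _
    rw [lmean_pure]
    exact hg x.2

/-- The stationary policy greedy for the supremum costs at most the supremum, once the nonnegative
terminal term is dropped. Conversely, every policy costs at least the `n`-th iterate, since the
terminal value at stage `0` is zero. -/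
theorem discountedValue_eq_iSup (Pbar : Matrix (Fin l) (Fin l) ℝ) (α : ℝ) (s : State) :
    M.discountedValue Pbar α s = ⨆ n, M.discountedIterate Pbar (ENNReal.ofReal α) n s := by
  apply le_antisymm
  · choose g hg using M.exists_discountedQFactor_iSup_le Pbar (ENNReal.ofReal α)
    refine (iInf_le _ fun _ s => PMF.pure (g s)).trans ?_
    rw [ENNReal.tsum_eq_iSup_nat]
    exact iSup_le fun n => le_self_add.trans (M.sum_expectedCost_le_of_greedy Pbar _ hg s n)
  · refine iSup_le fun n => le_iInf fun π => ?_
    have h := M.discountedIterate_le Pbar (ENNReal.ofReal α) π s 0 n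
    refine h.trans ?_
    simp only [discountedIterate, Pi.zero_apply, lmean_const, mul_zero, add_zero]
    exact ENNReal.sum_le_tsum _

theorem monotone_discountedValue {Pbar : Matrix (Fin l) (Fin l) ℝ}
    (hPbar : M.IsSteadyStateCov Pbar) (α : ℝ) : Monotone (M.discountedValue Pbar α) := by
  intro s t hst
  rw [discountedValue_eq_iSup, discountedValue_eq_iSup]
  exact iSup_mono fun n => M.monotone_discountedIterate hPbar _ n hst

theorem IsVanishingDiscountLimit.monotone {M : System l m} {Pbar : Matrix (Fin l) (Fin l) ℝ}
    (hPbar : M.IsSteadyStateCov Pbar) {sRef : State} {V : State → ℝ}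
    (hV : M.IsVanishingDiscountLimit Pbar sRef V) : Monotone V := by
  obtain ⟨α, -, -, hfin, hlim⟩ := hV
  -- Finiteness at the larger state matters: `toReal` sends `⊤` to `0` and is not monotone there.
  exact fun s t hst => le_of_tendsto_of_tendsto' (hlim s) (hlim t) fun n =>
    sub_le_sub_right (ENNReal.toReal_mono (hfin n t) (M.monotone_discountedValue hPbar _ hst)) _

end System

end WearingChannel

theorem proposition1 {l m : ℕ} (M : WearingChannel.System l m)
    (Pbar : Matrix (Fin l) (Fin l) ℝ) (hPbar : M.IsSteadyStateCov Pbar)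
    (V : WearingChannel.State → ℝ) (hV : M.IsRelativeValueFunction Pbar V) :
    (∀ τ : ℕ+, Monotone fun δ : ℕ+ => V (τ, δ)) ∧
      ∀ δ : ℕ+, Monotone fun τ : ℕ+ => V (τ, δ) := by
  obtain ⟨sRef, h⟩ := hV
  have hmono : Monotone V := h.elim (fun h => h.monotone hPbar) (fun h => h.monotone hPbar)
  exact ⟨fun τ _ _ h => hmono ⟨le_rfl, h⟩, fun δ _ _ h => hmono ⟨h, le_rfl⟩⟩
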